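/- Let $1\le p<\infty$, let $X$ and $Y$ be Banach spaces (over the same scalar field, $\mathbb R$ or $\mathbb C$), and let $L(X,Y)$ be the space of bounded linear operators from $X$ to $Y$ with the operator norm. For a Banach space $Z$ with dual $Z^*$, a sequence $(z_n)$ in $Z$ is weakly $p$-summable if $\sum_n |f(z_n)|^p<\infty$ for every $f\in Z^*$; a sequence $(f_n)$ in $Z^*$ is weak* $p$-summable if $\sum_n |f_n(z)|^p<\infty$ for every $z\in Z$. A set $A\subseteq Z$ is $p$-limited if for every weak* $p$-summable sequence $(f_n)$ in $Z^*$ there is $(a_n)\in\ell_p$ with $|f_n(z)|\le a_n$ for all $z\in A$ and all $n$. The space $Z$ has the weak $p$-GP property (weak Gelfand–Phillips property of order $p$) if every $p$-limited subset of $Z$ is relatively compact. A bounded linear operator between Banach spaces is $p$-summing if it maps weakly $p$-summable sequences to norm $p$-summable sequences (sequences $(y_n)$ with $\sum_n\|y_n\|^p<\infty$). A bounded linear operator $T$ from $Z$ to a Banach space is $p$-limited completely continuous ($p$-lcc) if $\|Tz_n\|\to 0$ for every weakly null sequence $(z_n)$ in $Z$ whose set of terms $\{z_n\}$ is $p$-limited.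 Theorem. Suppose that $X^*$ has the weak $p$-GP property. Let $M$ be a closed linear subspace of $L(X,Y)$ such that every $T\in M$ is $p$-summing and, for every $x\in X$, the evaluation operator $\phi_x:M\to Y$, $\phi_x(T)=Tx$, is $p$-lcc. Then $M$ has the weak $p$-GP property. -/

import Mathlib

open Filter Topology

section

variable (𝕜 : Type*) [RCLike 𝕜]
variable {X : Type*} [NormedAddCommGroup X] [NormedSpace 𝕜 X]
variable {Y : Type*} [NormedAddCommGroup Y] [NormedSpace 𝕜 Y]

/-- A sequence `(x n)` in `X` is weakly `p`-summable if `∑ |f (x n)| ^ p < ∞` for every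
continuous linear functional `f` on `X`. -/
def WeaklyPSummable (p : ℝ) (x : ℕ → X) : Prop :=
  ∀ f : StrongDual 𝕜 X, Summable fun n => ‖f (x n)‖ ^ p

/-- A sequence `(f n)` of continuous linear functionals on `X` is weak* `p`-summable if
`∑ |f n x| ^ p < ∞` for every `x` in `X`. -/
def WeakStarPSummable {𝕜 : Type*} [RCLike 𝕜] {X : Type*} [NormedAddCommGroup X]
    [NormedSpace 𝕜 X] (p : ℝ) (f : ℕ → StrongDual 𝕜 X) : Prop :=
  ∀ x : X, Summable fun n => ‖f n x‖ ^ p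

/-- A sequence `(x n)` in `X` is weakly null if it tends to `0` in the weak topology. -/
def WeaklyNull (x : ℕ → X) : Prop :=
  ∀ f : StrongDual 𝕜 X, Tendsto (fun n => f (x n)) atTop (𝓝 0)

/-- A set `A` in `X` is `p`-limited if for every weak* `p`-summable sequence `(f n)` in the dual
of `X` there is a sequence `a` in `ℓ_p` with `|f n x| ≤ a n` for all `x` in `A` and all `n`. -/
def IsPLimited (p : ℝ) (A : Set X) : Prop :=
  ∀ f : ℕ → StrongDual 𝕜 X, WeakStarPSummable p f →
    ∃ a : ℕ → ℝ, (Summable fun n => |a n| ^ p) ∧ ∀ x ∈ A, ∀ n, ‖f n x‖ ≤ a n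

variable (X) in
/-- `X` has the weak Gelfand-Phillips property of order `p` if every `p`-limited subset of `X` is
relatively compact. -/
def HasWeakPGP (p : ℝ) : Prop :=
  ∀ A : Set X, IsPLimited 𝕜 p A → IsCompact (closure A)

end

section

variable {𝕜 : Type*} [RCLike 𝕜]
variable {X : Type*} [NormedAddCommGroup X] [NormedSpace 𝕜 X]
variable {Y : Type*} [NormedAddCommGroup Y] [NormedSpace 𝕜 Y]

/-- A bounded operator is `p`-summing if it maps weakly `p`-summable sequences to norm
`p`-summable sequences. -/
def IsPSumming (p : ℝ) (T : X →L[𝕜] Y) : Prop :=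
  ∀ x : ℕ → X, WeaklyPSummable 𝕜 p x → Summable fun n => ‖T (x n)‖ ^ p

/-- A bounded operator is `p`-limited completely continuous (`p`-lcc) if it maps `p`-limited
weakly null sequences to norm null sequences. -/
def IsPLcc (p : ℝ) (T : X →L[𝕜] Y) : Prop :=
  ∀ x : ℕ → X, IsPLimited 𝕜 p (Set.range x) → WeaklyNull 𝕜 x →
    Tendsto (fun n => ‖T (x n)‖) atTop (𝓝 0)

/-- The evaluation operator `T ↦ T x` on a subspace `M` of the space `L(X, Y)`. -/
noncomputable def evalOn (M : Submodule 𝕜 (X →L[𝕜] Y)) (x : X) : M →L[𝕜] Y :=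
  (ContinuousLinearMap.apply 𝕜 Y x).comp M.subtypeL

end

/-!
Let `A ⊆ M` be `p`-limited. The proof shows that every sequence in `A` has a norm Cauchy
subsequence; since `M` is complete, the closure of `A` is then compact.

*Weakly Cauchy subsequences.* A sequence in any `p`-limited set has a weakly Cauchy subsequence
(`IsPLimited.exists_strictMono_tendsto_re`). If some gap `r < s` is such that, for every `N`, some
`N` terms `a₁, …, a_N` admit for each sign pattern `σ` a functional `f_σ` of the unit ball with
`Re f_σ (a_k)` above `s` or below `r` according to `σ_k`, then the Rademacher averages
`f_k = 2^{-N} ∑_σ σ_k f_σ` satisfy `∑_k |f_k z|^p ≤ √N ‖z‖^p` by Bessel's inequality, although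
`|f_k a_k| ≥ (s - r) / 2`. This contradicts the uniform form of `p`-limitedness for large `N`
(`IsPLimited.exists_not_independent`). A Rosenthal-type selection along an ultrafilter
(`exists_strictMono_forall_not_frequently`) turns the absence of such independent `N`-tuples, for
all rational gaps at once, into a subsequence along which no functional oscillates.

*Biduals.* If `T` is `p`-summing, `(ξ_k)` is weak* `p`-summable in `X**` and `y_k` lies in the
unit ball of `Y*`, then `∑ |ξ_k (y_k ∘ T)|^p < ∞` (`IsPSumming.summable_bidual`). Indeed a
Hahn–Banach argument of local reflexivity type (`exists_points_forall_sum_rpow_le`) replaces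
finitely many `ξ_k` by points `x_k` of `X` with comparable weak `p`-norm and
`y_k (T x_k) = ξ_k (y_k ∘ T)`, and the `p`-summing property is uniform on finite families.

*Weakly null sequences.* Let `(S_n)` be weakly null and `p`-limited in `M`, and choose `y_n` in the
unit ball of `Y*` with `‖S_n‖ ≤ 2 ‖y_n ∘ S_n‖`. By the previous paragraph the functionals
`T ↦ ξ_k (y_{m(k)} ∘ T)` on `M` form a weak* `p`-summable sequence for any choice of `m(k)`, and
with `m(k)` almost maximizing `|ξ_k (y_n ∘ S_n)|` over `n` this shows that `{y_n ∘ S_n}` is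
`p`-limited in `X*` (`IsPLimited.range_comp`), hence relatively compact. It tends to `0` pointwise,
because evaluations are `p`-limited completely continuous, so it tends to `0` in norm, and so does
`(S_n)`. Applied to differences of terms of a weakly Cauchy sequence, this shows that weakly Cauchy
sequences in `A` are norm Cauchy.
-/

/-! ### Uniform bounds on finite families -/

/-- If `ρ` is `p`-summable along every sequence along which all the seminorms `τ t` are, then this
holds uniformly on finite families: failing blocks, suitably rescaled, could otherwise be
concatenated into a counterexample. The weight `N` allows the bound to depend on `t`. -/
theorem exists_bound_of_forall_summable {𝕜 V D : Type*} [RCLike 𝕜] [AddCommGroup V] [Module 𝕜 V]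
    {p : ℝ} (hp : 0 < p) (τ : D → Seminorm 𝕜 V) (N : D → ℝ) (ρ : V → ℝ) (hρ : ∀ v, 0 ≤ ρ v)
    (hρs : ∀ (c : 𝕜) (v : V), ρ (c • v) = ‖c‖ * ρ v)
    (h : ∀ v : ℕ → V, (∀ t, Summable fun n => τ t (v n) ^ p) → Summable fun n => ρ (v n) ^ p) :
    ∃ K : ℝ, 0 ≤ K ∧ ∀ (s : Finset ℕ) (v : ℕ → V) (W : ℝ), 0 < W →
      (∀ t, ∑ k ∈ s, τ t (v k) ^ p ≤ W * N t) → ∑ k ∈ s, ρ (v k) ^ p ≤ K * W := by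
  by_contra! hcon
  -- Blocks on which the constant `2 ^ j` fails, to be rescaled so that the `j`-th one contributes
  -- at most `2⁻ʲ * N t` to the sum of `τ t ^ p`, but at least `1` to the sum of `ρ ^ p`.
  choose s v W hW hτ hlt using fun j : ℕ => hcon ((2 : ℝ) ^ j) (by positivity)
  set c : ℕ → ℝ := fun j => (((1 / 2 : ℝ) ^ j) / W j) ^ (1 / p) with hc
  have hc0 : ∀ j, 0 ≤ c j := fun j => by have := hW j; positivity
  have hcp : ∀ j, c j ^ p = ((1 / 2 : ℝ) ^ j) / W j := fun j => by
    have := hW j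
    rw [hc, ← Real.rpow_mul (by positivity), one_div_mul_cancel hp.ne', Real.rpow_one]
  set w : ℕ × ℕ → V := fun q => if q.2 ∈ s q.1 then ((c q.1 : ℝ) : 𝕜) • v q.1 q.2 else 0 with hw
  -- Block sums of a homogeneous function along the concatenated family.
  have key : ∀ σ : V → ℝ, (∀ v, 0 ≤ σ v) → (∀ (c : 𝕜) (v : V), σ (c • v) = ‖c‖ * σ v) → ∀ j,
      HasSum (fun k => σ (w (j, k)) ^ p)
        (((1 / 2 : ℝ) ^ j) / W j * ∑ k ∈ s j, σ (v j k) ^ p) := by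
    intro σ h0 hs j
    have hz : σ 0 = 0 := by simpa using hs 0 0
    have e : ∑ k ∈ s j, σ (w (j, k)) ^ p
        = ((1 / 2 : ℝ) ^ j) / W j * ∑ k ∈ s j, σ (v j k) ^ p := by
      rw [Finset.mul_sum]
      refine Finset.sum_congr rfl fun k hk => ?_
      simp only [hw, hk, if_true, hs]
      rw [Real.mul_rpow (norm_nonneg _) (h0 _), RCLike.norm_ofReal, abs_of_nonneg (hc0 j), hcp]
    rw [← e]
    refine hasSum_sum_of_ne_finset_zero fun k hk => ?_
    simp [hw, hk, hz, Real.zero_rpow hp.ne']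
  have hsum : ∀ t, Summable fun n : ℕ => τ t (w (Nat.pairEquiv.symm n)) ^ p := by
    intro t
    have k' := key (τ t) (fun _ => apply_nonneg _ _) (fun c v => map_smul_eq_mul _ c v)
    refine (Nat.pairEquiv.symm.summable_iff (f := fun q => τ t (w q) ^ p)).2 ?_
    refine (summable_prod_of_nonneg fun q => by positivity).2 ⟨fun j => (k' j).summable, ?_⟩
    refine Summable.of_nonneg_of_le (fun j => tsum_nonneg fun k => by positivity) (fun j => ?_)
      (summable_geometric_two.mul_right (N t))
    rw [(k' j).tsum_eq]
    have := hW j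
    calc _ ≤ ((1 / 2 : ℝ) ^ j) / W j * (W j * N t) := by gcongr; exact hτ j t
      _ = _ := by field_simp
  have h1 := (Nat.pairEquiv.symm.summable_iff (f := fun q => ρ (w q) ^ p)).1 (h _ hsum)
  have h2 := ((summable_prod_of_nonneg fun q => Real.rpow_nonneg (hρ _) _).1 h1).2
  have h3 := h2.tendsto_atTop_zero
  have h4 : ∀ j, 1 ≤ ∑' k, ρ (w (j, k)) ^ p := fun j => by
    rw [(key ρ hρ hρs j).tsum_eq]
    have := hW j
    calc (1 : ℝ) = ((1 / 2 : ℝ) ^ j) / W j * (2 ^ j * W j) := by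
          field_simp; rw [← mul_pow]; norm_num
      _ ≤ _ := by gcongr; exact (hlt j).le
  exact absurd (ge_of_tendsto' h3 h4) (by norm_num)

/-! ### Local reflexivity and summing operators -/

/-- Helly's theorem without norm control: on finitely many functionals, an element of the bidual
agrees with a point. -/
theorem exists_forall_apply_eq_bidual {𝕜 X ι : Type*} [RCLike 𝕜] [NormedAddCommGroup X]
    [NormedSpace 𝕜 X] [Finite ι] (φ : ι → StrongDual 𝕜 X) (ξ : StrongDual 𝕜 (StrongDual 𝕜 X)) :
    ∃ x : X, ∀ i, φ i x = ξ (φ i) := by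
  have := Fintype.ofFinite ι
  classical
  let Φ : X →ₗ[𝕜] (ι → 𝕜) := LinearMap.pi fun i => (φ i : X →ₗ[𝕜] 𝕜)
  suffices (fun i => ξ (φ i)) ∈ LinearMap.range Φ by
    obtain ⟨x, hx⟩ := this
    exact ⟨x, fun i => congrFun hx i⟩
  by_contra hn
  obtain ⟨l, hl, hk⟩ := Submodule.exists_le_ker_of_notMem hn
  have e : ∀ c : ι → 𝕜, l c = ∑ i, c i * l (Pi.single i 1) := fun c => by
    conv_lhs => rw [pi_eq_sum_univ' c]
    simp [map_sum]
  have hz : ∑ i, l (Pi.single i 1) • φ i = 0 := by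
    ext x
    have : l (Φ x) = 0 := hk ⟨x, rfl⟩
    rw [e] at this
    simpa [Φ, mul_comm] using this
  apply hl
  rw [e]
  have := congrArg ξ hz
  simpa [mul_comm] using this

/-- Simultaneous Helly theorem: if finitely many linear combinations of the `ξ k` have norm at most
`C`, there are points `x k` taking the prescribed values `ξ k (g k)` whose corresponding
combinations have norm less than `C + 1`. -/
theorem exists_forall_norm_sum_smul_lt {𝕜 X ι κ : Type*} [RCLike 𝕜] [NormedAddCommGroup X]
    [NormedSpace 𝕜 X] [Fintype ι] [Fintype κ] (ξ : κ → StrongDual 𝕜 (StrongDual 𝕜 X))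
    (g : κ → StrongDual 𝕜 X) (u : ι → κ → 𝕜) {C : ℝ} (hC : 0 ≤ C)
    (hu : ∀ i, ‖∑ k, u i k • ξ k‖ ≤ C) :
    ∃ x : κ → X, (∀ k, g k (x k) = ξ k (g k)) ∧ ∀ i, ‖∑ k, u i k • x k‖ < C + 1 := by
  classical
  let _ : NormedSpace ℝ X := NormedSpace.restrictScalars ℝ 𝕜 X
  have : IsScalarTower ℝ 𝕜 X := RestrictScalars.isScalarTower ℝ 𝕜 X
  by_contra! hcon
  let t : Set (ι → X) := {z | ∃ x : κ → X, (∀ k, g k (x k) = ξ k (g k)) ∧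
    ∀ i, z i = ∑ k, u i k • x k}
  let s : Set (ι → X) := Set.univ.pi fun _ => Metric.ball 0 (C + 1)
  have ht : Convex ℝ t := by
    rintro _ ⟨x, hx, hz⟩ _ ⟨x', hx', hz'⟩ a b ha hb hab
    refine ⟨a • x + b • x', fun k => ?_, fun i => ?_⟩
    · simp only [Pi.add_apply, Pi.smul_apply, map_add]
      rw [RCLike.real_smul_eq_coe_smul (K := 𝕜), RCLike.real_smul_eq_coe_smul (K := 𝕜) b, map_smul,
        map_smul, hx, hx', ← add_smul, ← RCLike.ofReal_add, hab]
      simp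
    · simp [hz, hz', Finset.smul_sum, smul_add, Finset.sum_add_distrib, smul_comm _ (u i _)]
  have hs : Convex ℝ s := convex_pi fun _ _ => convex_ball _ _
  have hso : IsOpen s := isOpen_set_pi Set.finite_univ fun _ _ => Metric.isOpen_ball
  have hd : Disjoint s t := by
    rw [Set.disjoint_left]
    rintro z hzs ⟨x, hx, hz⟩
    obtain ⟨i, hi⟩ := hcon x hx
    have := hzs i trivial
    rw [mem_ball_zero_iff, hz] at this
    exact absurd this (not_lt.2 hi)
  -- Separate the product of open balls from the convex set of admissible tuples of combinations.
  obtain ⟨f, m, hfs, hft⟩ := RCLike.geometric_hahn_banach_open (𝕜 := 𝕜) hs hso ht hd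
  let h : ι → StrongDual 𝕜 X := fun i => f.comp (ContinuousLinearMap.single 𝕜 (fun _ => X) i)
  have hf : ∀ z, f z = ∑ i, h i (z i) := fun z => by
    conv_lhs => rw [← Finset.univ_sum_single z]
    simp [h, map_sum]
  -- The tuple `x` agrees with `ξ` also on the components `h i` of the separating functional.
  choose x hx using fun k => exists_forall_apply_eq_bidual
    (fun o : Option ι => o.elim (g k) h) (ξ k)
  have h1 := hft (fun i => ∑ k, u i k • x k) ⟨x, fun k => hx k none, fun i => rfl⟩
  have e1 : f (fun i => ∑ k, u i k • x k) = ∑ i, (∑ k, u i k • ξ k) (h i) := by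
    rw [hf]
    refine Finset.sum_congr rfl fun i _ => ?_
    simp only [map_sum, map_smul, _root_.sum_apply, _root_.smul_apply]
    exact Finset.sum_congr rfl fun k _ => congrArg (u i k • ·) (hx k (some i))
  -- The open ball of radius `C + 1` leaves room to reach `C * ‖h i‖` exactly.
  have hz : ∀ i, ∃ z : X, ‖z‖ < C + 1 ∧ C * ‖h i‖ ≤ RCLike.re (h i z) := by
    intro i
    by_cases h0 : h i = 0
    · exact ⟨0, by simp; linarith, by simp [h0]⟩
    have hpos : 0 < ‖h i‖ := norm_pos_iff.2 h0
    obtain ⟨z, hz1, hz2⟩ := ContinuousLinearMap.exists_lt_apply_of_lt_opNorm (h i)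
      (r := C / (C + 1) * ‖h i‖) (by
        have : C / (C + 1) < 1 := by rw [div_lt_one (by linarith)]; linarith
        nlinarith)
    have hne : h i z ≠ 0 := fun h0 => by
      rw [h0, norm_zero] at hz2
      exact absurd hz2 (not_lt.2 (by positivity))
    refine ⟨((C + 1 : ℝ) : 𝕜) • ((‖h i z‖ : 𝕜) / h i z) • z, ?_, ?_⟩
    · rw [norm_smul, norm_smul, RCLike.norm_ofReal, norm_div, RCLike.norm_ofReal, abs_norm,
        div_self (norm_ne_zero_iff.2 hne), abs_of_nonneg (by linarith)]
      nlinarith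
    · rw [(h i).map_smul, (h i).map_smul, smul_eq_mul, smul_eq_mul, div_mul_cancel₀ _ hne,
        ← RCLike.ofReal_mul, RCLike.ofReal_re]
      have : C / (C + 1) * ‖h i‖ * (C + 1) = C * ‖h i‖ := by field_simp
      nlinarith
  choose z hz1 hz2 using hz
  have h2 := hfs z fun i _ => mem_ball_zero_iff.2 (hz1 i)
  rw [hf, map_sum] at h2
  rw [e1, map_sum] at h1
  have h3 : ∑ i, RCLike.re ((∑ k, u i k • ξ k) (h i)) ≤ ∑ i, RCLike.re (h i (z i)) :=
    Finset.sum_le_sum fun i _ =>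
      ((RCLike.re_le_norm _).trans (((∑ k, u i k • ξ k).le_opNorm (h i)).trans
        (mul_le_mul_of_nonneg_right (hu i) (norm_nonneg _)))).trans (hz2 i)
  linarith

theorem PiLp.norm_toLp_rpow {𝕜 κ : Type*} [RCLike 𝕜] [Fintype κ] {p : ℝ} (hp : 0 < p)
    (a : κ → 𝕜) :
    ‖(WithLp.toLp (ENNReal.ofReal p) a : PiLp (ENNReal.ofReal p) fun _ : κ => 𝕜)‖ ^ p
      = ∑ k, ‖a k‖ ^ p := by
  have h := ENNReal.toReal_ofReal hp.le
  rw [PiLp.norm_eq_sum (by rwa [h]), h, ← Real.rpow_mul (by positivity),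
    one_div_mul_cancel hp.ne', Real.rpow_one]

theorem PiLp.norm_toLp_le_iff {𝕜 κ : Type*} [RCLike 𝕜] [Fintype κ] {p : ℝ} (hp : 0 < p)
    (a : κ → 𝕜) {B : ℝ} (hB : 0 ≤ B) :
    ‖(WithLp.toLp (ENNReal.ofReal p) a : PiLp (ENNReal.ofReal p) fun _ : κ => 𝕜)‖ ≤ B
      ↔ ∑ k, ‖a k‖ ^ p ≤ B ^ p := by
  rw [← PiLp.norm_toLp_rpow hp, Real.rpow_le_rpow_iff _ hB hp]
  rw [PiLp.norm_eq_sum (by rwa [ENNReal.toReal_ofReal hp.le])]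
  positivity

theorem PiLp.map_toLp_eq_sum {𝕜 κ : Type*} [RCLike 𝕜] [Fintype κ] [DecidableEq κ]
    {q : ENNReal} [Fact (1 ≤ q)]
    (ψ : StrongDual 𝕜 (PiLp q fun _ : κ => 𝕜)) (a : κ → 𝕜) :
    ψ (WithLp.toLp q a) = ∑ k, ψ (WithLp.toLp q (Pi.single k 1)) * a k := by
  conv_lhs => rw [pi_eq_sum_univ' a]
  simp [map_sum, mul_comm]

/-- Uniform boundedness for a weak* `p`-summable sequence. The functionals
`z ↦ ψ (ξ 0 z, …, ξ (n - 1) z)`, with `ψ` in the dual unit ball of `ℓ_p^n` and `n` arbitrary, are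
pointwise bounded. -/
theorem WeakStarPSummable.exists_bound {𝕜 Z : Type*} [RCLike 𝕜] [NormedAddCommGroup Z]
    [NormedSpace 𝕜 Z] [CompleteSpace Z] {p : ℝ} (hp : 1 ≤ p) {ξ : ℕ → StrongDual 𝕜 Z}
    (hξ : WeakStarPSummable p ξ) :
    ∃ C : ℝ, 0 ≤ C ∧ ∀ (n : ℕ) (z : Z), ∑ k : Fin n, ‖ξ k z‖ ^ p ≤ (C * ‖z‖) ^ p := by
  have hp0 : 0 < p := by linarith
  have : Fact (1 ≤ ENNReal.ofReal p) := ⟨by simpa using ENNReal.ofReal_le_ofReal hp⟩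
  let F := fun q : Σ n : ℕ, {ψ : StrongDual 𝕜 (PiLp (ENNReal.ofReal p) fun _ : Fin n => 𝕜) //
      ‖ψ‖ ≤ 1} =>
    ∑ k : Fin q.1, q.2.1 (WithLp.toLp _ (Pi.single k 1)) • ξ k
  have hF : ∀ q z, F q z = q.2.1 (WithLp.toLp _ fun k : Fin q.1 => ξ k z) := fun q z => by
    rw [PiLp.map_toLp_eq_sum]
    simp [F]
  obtain ⟨C, hC⟩ := banach_steinhaus (g := F) fun z => by
    refine ⟨(∑' k, ‖ξ k z‖ ^ p) ^ (1 / p), fun q => ?_⟩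
    rw [hF]
    refine (q.2.1.le_opNorm _).trans ?_
    refine (mul_le_of_le_one_left (norm_nonneg _) q.2.2).trans ?_
    have h0 : 0 ≤ ∑' k, ‖ξ k z‖ ^ p := tsum_nonneg fun _ => by positivity
    rw [PiLp.norm_toLp_le_iff hp0 _ (by positivity), ← Real.rpow_mul h0,
      one_div_mul_cancel hp0.ne', Real.rpow_one, ← Finset.sum_range fun k => ‖ξ k z‖ ^ p]
    exact (hξ z).sum_le_tsum _ fun _ _ => by positivity
  have hC0 : 0 ≤ C := (norm_nonneg _).trans (hC ⟨0, 0, by simp⟩)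
  refine ⟨C, hC0, fun n z => ?_⟩
  rw [← PiLp.norm_toLp_le_iff hp0 (fun k : Fin n => ξ k z) (by positivity)]
  obtain ⟨ψ, hψ, hψz⟩ := exists_dual_vector'' 𝕜
    (WithLp.toLp (ENNReal.ofReal p) fun k : Fin n => ξ k z)
  have h1 := (F ⟨n, ψ, hψ⟩).le_of_opNorm_le (hC _) z
  rw [hF, hψz, RCLike.norm_ofReal, abs_norm] at h1
  exact h1

/-- A weak form of local reflexivity: finitely many elements `ξ k` of the bidual can be replaced by
points `x k` with prescribed values `g k (x k) = ξ k (g k)`, at the cost of a constant in the weak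
`p`-norm. -/
theorem exists_points_forall_sum_rpow_le {𝕜 X κ : Type*} [RCLike 𝕜] [NormedAddCommGroup X]
    [NormedSpace 𝕜 X] [Fintype κ] {p : ℝ} (hp : 1 ≤ p)
    (ξ : κ → StrongDual 𝕜 (StrongDual 𝕜 X)) (g : κ → StrongDual 𝕜 X) {C : ℝ} (hC : 0 ≤ C)
    (hξ : ∀ h, ∑ k, ‖ξ k h‖ ^ p ≤ (C * ‖h‖) ^ p) :
    ∃ x : κ → X, (∀ k, g k (x k) = ξ k (g k)) ∧
      ∀ h : StrongDual 𝕜 X, ∑ k, ‖h (x k)‖ ^ p ≤ (2 * (C + 1) * ‖h‖) ^ p := by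
  classical
  have hp0 : 0 < p := by linarith
  have : Fact (1 ≤ ENNReal.ofReal p) := ⟨by simpa using ENNReal.ofReal_le_ofReal hp⟩
  let E := PiLp (ENNReal.ofReal p) fun _ : κ => 𝕜
  have : FiniteDimensional 𝕜 (StrongDual 𝕜 E) := inferInstance
  have : ProperSpace (StrongDual 𝕜 E) := FiniteDimensional.proper 𝕜 _
  -- A finite `1/2`-net of the dual ball of `ℓ_p^κ` determines the norm up to a factor `2`.
  obtain ⟨t, ht, htf, htc⟩ := (isCompact_closedBall (0 : StrongDual 𝕜 E) 1).finite_cover_balls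
    (e := 1 / 2) (by norm_num)
  have := htf.fintype
  obtain ⟨x, hx, hxu⟩ := exists_forall_norm_sum_smul_lt ξ g
    (fun (i : t) k => i.1 (WithLp.toLp _ (Pi.single k 1))) hC fun i => by
      refine ContinuousLinearMap.opNorm_le_bound _ hC fun h => ?_
      have e : (∑ k, i.1 (WithLp.toLp _ (Pi.single k 1)) • ξ k) h
          = i.1 (WithLp.toLp _ fun k => ξ k h) := by
        rw [PiLp.map_toLp_eq_sum]; simp
      rw [e]
      refine (i.1.le_opNorm _).trans ((mul_le_of_le_one_left (norm_nonneg _)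
        (mem_closedBall_zero_iff.1 (ht i.2))).trans ?_)
      exact (PiLp.norm_toLp_le_iff hp0 _ (by positivity)).2 (hξ h)
  refine ⟨x, hx, fun h => ?_⟩
  rw [← PiLp.norm_toLp_le_iff hp0 (fun k => h (x k)) (by positivity)]
  set a : E := WithLp.toLp _ fun k => h (x k) with ha
  obtain ⟨ψ, hψ, hψa⟩ := exists_dual_vector'' 𝕜 a
  obtain ⟨i, hit, hi⟩ := Set.mem_iUnion₂.1 (htc (mem_closedBall_zero_iff.2 hψ))
  rw [mem_ball_iff_norm] at hi
  have h1 : i a = h (∑ k, i (WithLp.toLp _ (Pi.single k 1)) • x k) := by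
    rw [ha, PiLp.map_toLp_eq_sum]; simp
  have h2 : ‖i a‖ ≤ ‖h‖ * (C + 1) := by
    rw [h1]
    exact (h.le_opNorm _).trans (mul_le_mul_of_nonneg_left (hxu ⟨i, hit⟩).le (norm_nonneg _))
  have h3 : ‖(ψ - i) a‖ ≤ 1 / 2 * ‖a‖ := (ψ - i).le_of_opNorm_le hi.le a
  have h4 : ‖a‖ ≤ ‖(ψ - i) a‖ + ‖i a‖ := by
    calc ‖a‖ = ‖ψ a‖ := by rw [hψa, RCLike.norm_ofReal, abs_norm]
      _ = ‖(ψ - i) a + i a‖ := by simp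
      _ ≤ _ := norm_add_le _ _
  linarith

/-- The usual `p`-summing inequality on finite families. -/
theorem IsPSumming.exists_bound {𝕜 X Y : Type*} [RCLike 𝕜] [NormedAddCommGroup X]
    [NormedSpace 𝕜 X] [NormedAddCommGroup Y] [NormedSpace 𝕜 Y] {p : ℝ} (hp : 0 < p)
    {T : X →L[𝕜] Y} (hT : IsPSumming p T) :
    ∃ K : ℝ, ∀ (n : ℕ) (x : Fin n → X) (W : ℝ), 0 < W →
      (∀ h : StrongDual 𝕜 X, ∑ k, ‖h (x k)‖ ^ p ≤ W * ‖h‖ ^ p) → ∑ k, ‖T (x k)‖ ^ p ≤ K * W := by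
  obtain ⟨K, -, hK⟩ := exists_bound_of_forall_summable (𝕜 := 𝕜) hp
    (fun h : StrongDual 𝕜 X => (normSeminorm 𝕜 𝕜).comp h.toLinearMap) (fun h => ‖h‖ ^ p)
    (fun x => ‖T x‖) (fun _ => norm_nonneg _) (fun c x => by rw [map_smul, norm_smul])
    (fun x hx => hT x hx)
  refine ⟨K, fun n x W hW h => ?_⟩
  have := hK (Finset.range n) (fun k => if hk : k < n then x ⟨k, hk⟩ else 0) W hW fun g => by
    rw [Finset.sum_range]
    simpa using h g
  rw [Finset.sum_range] at this
  simpa using this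

/-- The bidual of a `p`-summing operator is `p`-summing, tested against functionals on `Y`. -/
theorem IsPSumming.summable_bidual {𝕜 X Y : Type*} [RCLike 𝕜] [NormedAddCommGroup X]
    [NormedSpace 𝕜 X] [NormedAddCommGroup Y] [NormedSpace 𝕜 Y] {p : ℝ} (hp : 1 ≤ p)
    {T : X →L[𝕜] Y} (hT : IsPSumming p T) {ξ : ℕ → StrongDual 𝕜 (StrongDual 𝕜 X)}
    (hξ : WeakStarPSummable p ξ) (y : ℕ → StrongDual 𝕜 Y) (hy : ∀ k, ‖y k‖ ≤ 1) :
    Summable fun k => ‖ξ k ((y k).comp T)‖ ^ p := by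
  obtain ⟨C, hC, hCξ⟩ := hξ.exists_bound hp
  obtain ⟨K, hK⟩ := hT.exists_bound (by linarith)
  refine summable_of_sum_range_le (c := K * (2 * (C + 1)) ^ p) (fun _ => by positivity) fun n => ?_
  obtain ⟨x, hx, hxw⟩ := exists_points_forall_sum_rpow_le hp (fun k : Fin n => ξ k)
    (fun k => (y k).comp T) hC (hCξ n)
  rw [Finset.sum_range]
  refine le_trans (Finset.sum_le_sum fun k _ => ?_)
    (hK n x ((2 * (C + 1)) ^ p) (by positivity) fun h => ?_)
  · rw [← hx k]
    exact Real.rpow_le_rpow (norm_nonneg _) (((y k).le_of_opNorm_le (hy k) _).trans_eq (one_mul _))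
      (by linarith)
  · rw [← Real.mul_rpow (by positivity) (norm_nonneg _)]
    exact hxw h

/-! ### Selecting a subsequence without oscillation -/

/-- A word `D₁ D₂ … D_m` of sequences of sets is realized on `S` along the ultrafilter `U` if, for
`U`-almost all `n₁`, for `U`-almost all `n₂`, and so on, the set
`S ∩ D₁ n₁ ∩ D₂ n₂ ∩ … ∩ D_m n_m` is nonempty. -/
def UltraRealizes {α : Type*} (U : Ultrafilter ℕ) : List (ℕ → Set α) → Set α → Prop
  | [], S => S.Nonempty
  | D :: w, S => ∀ᶠ n in (U : Filter ℕ), UltraRealizes U w (S ∩ D n)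

/-- If all sign patterns of length `N` are realized, a single choice of `N` indices serves all of
them. The finite family `S` carries the patterns fixed so far. -/
theorem exists_points_of_ultraRealizes {α : Type*} {U : Ultrafilter ℕ} (C : Bool → ℕ → Set α)
    (N : ℕ) : ∀ {ι : Type} [Finite ι] (S : ι → Set α),
      (∀ i, ∀ σ : Fin N → Bool, UltraRealizes U (List.ofFn fun k => C (σ k)) (S i)) →
      ∃ n : Fin N → ℕ, ∀ i, ∀ σ : Fin N → Bool, ∃ f ∈ S i, ∀ k, f ∈ C (σ k) (n k) := by
  induction N with
  | zero =>
    intro ι _ S h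
    refine ⟨Fin.elim0, fun i σ => ?_⟩
    obtain ⟨f, hf⟩ : (S i).Nonempty := by simpa [UltraRealizes] using h i σ
    exact ⟨f, hf, fun k => k.elim0⟩
  | succ N ih =>
    intro ι _ S h
    have h' : ∀ᶠ n in (U : Filter ℕ), ∀ q : ι × Bool, ∀ σ : Fin N → Bool,
        UltraRealizes U (List.ofFn fun k => C (σ k)) (S q.1 ∩ C q.2 n) := by
      rw [eventually_all]
      rintro ⟨i, b⟩
      rw [eventually_all]
      intro σ
      have := h i (Fin.cons b σ)
      rw [List.ofFn_succ] at this
      simpa [UltraRealizes] using this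
    obtain ⟨n, hn⟩ := h'.exists
    obtain ⟨m, hm⟩ := ih _ hn
    refine ⟨Fin.cons n m, fun i σ => ?_⟩
    obtain ⟨f, ⟨hf, hf0⟩, hfs⟩ := hm (i, σ 0) (Fin.tail σ)
    exact ⟨f, hf, Fin.cases hf0 hfs⟩

/-- Unrealized words can be avoided along a subsequence. It is built term by term, keeping a growing
finite family of unrealized pairs `(word, set)` and choosing each term so that removing the first
letter of any of these words, and cutting down its set accordingly, leaves it unrealized. A point
meeting every letter of such a word infinitely often would end up in a set on which the empty word
is not realized, that is, in the empty set. -/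
theorem exists_strictMono_not_ultraRealizes {α : Type*} {U : Ultrafilter ℕ}
    (hU : (U : Filter ℕ) ≤ atTop) (w : ℕ → List (ℕ → Set α))
    (hw : ∀ j, ¬ UltraRealizes U (w j) Set.univ) :
    ∃ φ : ℕ → ℕ, StrictMono φ ∧ ∀ j (f : α), ∃ D ∈ w j, ¬ ∃ᶠ n in atTop, f ∈ D (φ n) := by
  classical
  -- A state is a finite family of unrealizable pairs `(word, set)`.
  -- `g n` consumes the first letter of a word, evaluated at `n`.
  let g : ℕ → List (ℕ → Set α) × Set α → List (ℕ → Set α) × Set α := fun n q =>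
    match q with
    | ([], S) => ([], S)
    | (D :: v, S) => (v, S ∩ D n)
  let St := {q : ℕ × Set (List (ℕ → Set α) × Set α) //
    q.2.Finite ∧ ∀ x ∈ q.2, ¬ UltraRealizes U x.1 x.2}
  have hstep : ∀ q : St, ∃ n, q.1.1 < n ∧ ∀ x ∈ q.1.2, ¬ UltraRealizes U (g n x).1 (g n x).2 := by
    intro q
    have h1 : ∀ᶠ n in (U : Filter ℕ), q.1.1 < n := hU (eventually_gt_atTop _)
    have h2 : ∀ᶠ n in (U : Filter ℕ), ∀ x ∈ q.1.2, ¬ UltraRealizes U (g n x).1 (g n x).2 := by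
      rw [eventually_all_finite q.2.1]
      rintro ⟨v, S⟩ hx
      have := q.2.2 _ hx
      cases v with
      | nil => exact Eventually.of_forall fun n => this
      | cons D v => exact Ultrafilter.eventually_not.2 this
    exact (h1.and h2).exists
  choose next hnext hbad using hstep
  -- The word `w t` enters the family at time `t`.
  let step : ℕ → St → St := fun t q =>
    ⟨(next q, insert (w t, Set.univ) (q.1.2 ∪ g (next q) '' q.1.2)),
      (q.2.1.union (q.2.1.image _)).insert _, by
        rintro x (rfl | hx | ⟨y, hy, rfl⟩)
        · exact hw t
        · exact q.2.2 _ hx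
        · exact hbad _ _ hy⟩
  let st : ℕ → St := fun t => Nat.rec ⟨(0, ∅), Set.finite_empty, by simp⟩ step t
  have hst : ∀ t, st (t + 1) = step t (st t) := fun t => rfl
  have hmono : Monotone fun t => (st t).1.2 := monotone_nat_of_le_succ fun t => by
    rw [hst]
    exact Set.subset_union_left.trans (Set.subset_insert _ _)
  refine ⟨fun t => next (st t), strictMono_nat_of_lt_succ fun t => hnext (st (t + 1)), ?_⟩
  intro j f
  by_contra! hcon
  have key : ∀ (v : List (ℕ → Set α)) (S : Set α) (t : ℕ), (v, S) ∈ (st t).1.2 → f ∈ S →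
      (∀ D ∈ v, ∃ᶠ n in atTop, f ∈ D (next (st n))) → False := by
    intro v
    induction v with
    | nil => exact fun S t hS hf _ => (st t).2.2 _ hS ⟨f, hf⟩
    | cons D v ih =>
      intro S t hS hf hD
      obtain ⟨t', ht', hft'⟩ := frequently_atTop.1 (hD D (by simp)) t
      refine ih (S ∩ D (next (st t'))) (t' + 1) ?_ ⟨hf, hft'⟩ fun E hE => hD E (by simp [hE])
      rw [hst]
      exact Or.inr (Or.inr ⟨_, hmono ht' hS, rfl⟩)
  exact key (w j) Set.univ (j + 1) (by rw [hst]; exact Or.inl rfl) trivial hcon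

/-- Selection principle of Rosenthal type. If for each `j` in a countable set the pairs
`(C j true n, C j false n)` admit no independent subfamilies of some size `N`, then along some
subsequence no point lies infinitely often in both members of the pairs, for any `j`. -/
theorem exists_strictMono_forall_not_frequently {α ι : Type*} [Countable ι]
    (C : ι → Bool → ℕ → Set α)
    (hC : ∀ j, ∃ N : ℕ, ∀ n : Fin N → ℕ, ∃ σ : Fin N → Bool, ∀ f, ∃ k, f ∉ C j (σ k) (n k)) :
    ∃ φ : ℕ → ℕ, StrictMono φ ∧ ∀ j (f : α), ∃ b, ¬ ∃ᶠ n in atTop, f ∈ C j b (φ n) := by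
  rcases isEmpty_or_nonempty ι with hι | hι
  · exact ⟨id, strictMono_id, fun j => isEmptyElim j⟩
  obtain ⟨e, he⟩ := exists_surjective_nat ι
  let U : Ultrafilter ℕ := hyperfilter ℕ
  have hU : (U : Filter ℕ) ≤ atTop := by
    rw [← Nat.cofinite_eq_atTop]; exact hyperfilter_le_cofinite
  have hw : ∀ j, ∃ w : List (ℕ → Set α), (∀ D ∈ w, ∃ b, D = C j b) ∧
      ¬ UltraRealizes U w Set.univ := by
    intro j
    obtain ⟨N, hN⟩ := hC j
    by_contra! hcon
    obtain ⟨n, hn⟩ := exists_points_of_ultraRealizes (U := U) (C j) N (fun _ : Unit => Set.univ)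
      fun _ σ => hcon _ (by simp only [List.mem_ofFn]; rintro D ⟨k, rfl⟩; exact ⟨_, rfl⟩)
    obtain ⟨σ, hσ⟩ := hN n
    obtain ⟨f, -, hf⟩ := hn () σ
    obtain ⟨k, hk⟩ := hσ f
    exact hk (hf k)
  choose w hwC hw using hw
  obtain ⟨φ, hφ, h⟩ := exists_strictMono_not_ultraRealizes hU (fun j => w (e j)) fun j => hw (e j)
  refine ⟨φ, hφ, fun j f => ?_⟩
  obtain ⟨i, rfl⟩ := he j
  obtain ⟨D, hD, hf⟩ := h i f
  obtain ⟨b, rfl⟩ := hwC _ _ hD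
  exact ⟨b, hf⟩

/-! ### Weakly Cauchy subsequences of `p`-limited sequences -/

/-- The sign `±1`, as a scalar, of a Boolean. -/
def boolSign (𝕜 : Type*) [RCLike 𝕜] (b : Bool) : 𝕜 := if b then 1 else -1

theorem boolSign_not {𝕜 : Type*} [RCLike 𝕜] (b : Bool) : boolSign 𝕜 (!b) = -boolSign 𝕜 b := by
  cases b <;> simp [boolSign]

theorem boolSign_mul_self {𝕜 : Type*} [RCLike 𝕜] (b : Bool) :
    boolSign 𝕜 b * boolSign 𝕜 b = 1 := by
  cases b <;> simp [boolSign]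

theorem conj_boolSign {𝕜 : Type*} [RCLike 𝕜] (b : Bool) :
    (starRingEnd 𝕜) (boolSign 𝕜 b) = boolSign 𝕜 b := by
  cases b <;> simp [boolSign]

theorem norm_boolSign {𝕜 : Type*} [RCLike 𝕜] (b : Bool) : ‖boolSign 𝕜 b‖ = 1 := by
  cases b <;> simp [boolSign]

theorem sum_boolSign {𝕜 κ : Type*} [RCLike 𝕜] [Fintype κ] [DecidableEq κ] (k : κ) :
    ∑ σ : κ → Bool, boolSign 𝕜 (σ k) = 0 := by
  refine Finset.sum_involution (fun σ _ => Function.update σ k (!σ k)) ?_ ?_ (by simp) ?_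
  · simp [boolSign_not]
  · intro σ _ _ h
    simpa using congrFun h k
  · simp

theorem sum_boolSign_mul_boolSign {𝕜 κ : Type*} [RCLike 𝕜] [Fintype κ] [DecidableEq κ] {j k : κ}
    (hjk : j ≠ k) : ∑ σ : κ → Bool, boolSign 𝕜 (σ j) * boolSign 𝕜 (σ k) = 0 := by
  refine Finset.sum_involution (fun σ _ => Function.update σ k (!σ k)) ?_ ?_ (by simp) ?_
  · simp [boolSign_not, hjk]
  · intro σ _ _ h
    simpa using congrFun h k
  · simp

/-- Bessel's inequality for the Rademacher functions on `κ → Bool`. -/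
theorem sum_norm_sq_sum_boolSign_mul_le {𝕜 κ : Type*} [RCLike 𝕜] [Fintype κ] [DecidableEq κ]
    (F : (κ → Bool) → 𝕜) :
    ∑ k, ‖∑ σ : κ → Bool, boolSign 𝕜 (σ k) * F σ‖ ^ 2
      ≤ 2 ^ Fintype.card κ * ∑ σ, ‖F σ‖ ^ 2 := by
  set c : ℝ := (√(2 ^ Fintype.card κ))⁻¹ with hc
  have hc2 : c ^ 2 = (2 ^ Fintype.card κ)⁻¹ := by rw [hc, inv_pow, Real.sq_sqrt (by positivity)]
  have hc2' : (c : 𝕜) * c = (2 ^ Fintype.card κ)⁻¹ := by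
    rw [← sq, ← RCLike.ofReal_pow, hc2]
    simp only [RCLike.ofReal_inv, RCLike.ofReal_pow, RCLike.ofReal_ofNat]
  let v : κ → EuclideanSpace 𝕜 (κ → Bool) := fun k =>
    WithLp.toLp 2 fun σ => (c : 𝕜) * boolSign 𝕜 (σ k)
  have hv : Orthonormal 𝕜 v := by
    rw [orthonormal_iff_ite]
    intro j k
    have e : inner 𝕜 (v j) (v k)
        = ((c : 𝕜) * c) * ∑ σ : κ → Bool, boolSign 𝕜 (σ j) * boolSign 𝕜 (σ k) := by
      simp only [v, PiLp.inner_apply, RCLike.inner_apply, map_mul, RCLike.conj_ofReal,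
        conj_boolSign, Finset.mul_sum]
      exact Finset.sum_congr rfl fun σ _ => by ring
    rw [e, hc2']
    split_ifs with h
    · subst h
      simp [boolSign_mul_self]
    · rw [sum_boolSign_mul_boolSign h, mul_zero]
  have hb := hv.sum_inner_products_le (WithLp.toLp 2 F) (s := Finset.univ)
  have e : ∀ k, ‖inner 𝕜 (v k) (WithLp.toLp 2 F)‖ ^ 2
      = (2 ^ Fintype.card κ)⁻¹ * ‖∑ σ : κ → Bool, boolSign 𝕜 (σ k) * F σ‖ ^ 2 := by
    intro k
    have : inner 𝕜 (v k) (WithLp.toLp 2 F)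
        = (c : 𝕜) * ∑ σ : κ → Bool, boolSign 𝕜 (σ k) * F σ := by
      simp only [v, PiLp.inner_apply, RCLike.inner_apply, map_mul, RCLike.conj_ofReal,
        conj_boolSign, Finset.mul_sum]
      exact Finset.sum_congr rfl fun σ _ => by ring
    rw [this, norm_mul, mul_pow, RCLike.norm_ofReal, sq_abs, hc2]
  simp only [e, ← Finset.mul_sum, EuclideanSpace.norm_sq_eq] at hb
  rwa [inv_mul_le_iff₀ (by positivity)] at hb

theorem sum_norm_rademacher_average_le {𝕜 κ : Type*} [RCLike 𝕜] [Fintype κ] [DecidableEq κ]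
    (F : (κ → Bool) → 𝕜) {B : ℝ} (hB : 0 ≤ B) (hF : ∀ σ, ‖F σ‖ ≤ B) :
    ∑ k, ‖(2 ^ Fintype.card κ : 𝕜)⁻¹ * ∑ σ : κ → Bool, boolSign 𝕜 (σ k) * F σ‖
      ≤ √(Fintype.card κ) * B := by
  refine abs_le_of_sq_le_sq' ?_ (by positivity) |>.2
  rw [mul_pow, Real.sq_sqrt (by positivity)]
  refine sq_sum_le_card_mul_sum_sq.trans ?_
  rw [Finset.card_univ]
  gcongr
  simp only [norm_mul, mul_pow, ← Finset.mul_sum]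
  have h1 := sum_norm_sq_sum_boolSign_mul_le F
  have h2 : ∑ σ, ‖F σ‖ ^ 2 ≤ 2 ^ Fintype.card κ * B ^ 2 := by
    refine (Finset.sum_le_sum fun σ _ => pow_le_pow_left₀ (norm_nonneg _) (hF σ) 2).trans ?_
    simp
  have h3 : ‖(2 ^ Fintype.card κ : 𝕜)⁻¹‖ = (2 ^ Fintype.card κ : ℝ)⁻¹ := by simp
  rw [h3]
  calc _ ≤ ((2 ^ Fintype.card κ : ℝ)⁻¹) ^ 2 *
        (2 ^ Fintype.card κ * (2 ^ Fintype.card κ * B ^ 2)) := by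
        gcongr
        exact h1.trans (by gcongr)
    _ = B ^ 2 := by field_simp

section PLimited

variable {𝕜 Z : Type*} [RCLike 𝕜] [NormedAddCommGroup Z] [NormedSpace 𝕜 Z] {p : ℝ}

theorem IsPLimited.mono {A B : Set Z} (h : A ⊆ B) (hB : IsPLimited 𝕜 p B) : IsPLimited 𝕜 p A :=
  fun f hf => let ⟨a, ha, haB⟩ := hB f hf; ⟨a, ha, fun x hx => haB x (h hx)⟩

/-- Test the definition on the sequence `f, 0, 0, …`. -/
theorem IsPLimited.bddAbove_norm_apply (hp : 0 < p) {A : Set Z} (hA : IsPLimited 𝕜 p A)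
    (f : StrongDual 𝕜 Z) : BddAbove (Set.range fun a : A => ‖f a‖) := by
  obtain ⟨a, -, ha⟩ := hA (fun n => if n = 0 then f else 0) fun z =>
    summable_of_ne_finset_zero (s := {0}) fun n hn => by
      simp at hn; simp [hn, Real.zero_rpow hp.ne']
  refine ⟨a 0, ?_⟩
  rintro _ ⟨z, rfl⟩
  simpa using ha z z.2 0

theorem IsPLimited.exists_norm_le (hp : 0 < p) {A : Set Z} (hA : IsPLimited 𝕜 p A) :
    ∃ R : ℝ, ∀ z ∈ A, ‖z‖ ≤ R := by
  obtain ⟨R, hR⟩ := banach_steinhaus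
    (g := fun a : A => NormedSpace.inclusionInDoubleDual 𝕜 Z a) fun f => by
      obtain ⟨c, hc⟩ := hA.bddAbove_norm_apply hp f
      exact ⟨c, fun a => by simpa using hc ⟨a, rfl⟩⟩
  refine ⟨R, fun z hz => ?_⟩
  have := hR ⟨z, hz⟩
  rwa [← (NormedSpace.inclusionInDoubleDualLi 𝕜 (E := Z)).norm_map z]

/-- Uniform form of `p`-limitedness on finite families, with a point of the set chosen for each
functional. -/
theorem IsPLimited.exists_bound (hp : 0 < p) {A : Set Z} (hA : IsPLimited 𝕜 p A) :
    ∃ K : ℝ, ∀ (n : ℕ) (f : Fin n → StrongDual 𝕜 Z) (a : Fin n → A) (W : ℝ), 0 < W →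
      (∀ z, ∑ k, ‖f k z‖ ^ p ≤ W * ‖z‖ ^ p) → ∑ k, ‖f k (a k)‖ ^ p ≤ K * W := by
  have hb := hA.bddAbove_norm_apply hp
  have h0 : ∀ f : StrongDual 𝕜 Z, 0 ≤ ⨆ a : A, ‖f a‖ := fun f =>
    Real.iSup_nonneg fun _ => norm_nonneg _
  obtain ⟨K, -, hK⟩ := exists_bound_of_forall_summable (𝕜 := 𝕜) hp
    (fun z : Z => (normSeminorm 𝕜 𝕜).comp (NormedSpace.inclusionInDoubleDual 𝕜 Z z).toLinearMap)
    (fun z => ‖z‖ ^ p) (fun f : StrongDual 𝕜 Z => ⨆ a : A, ‖f a‖) h0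
    (fun c f => by simp [norm_mul, Real.mul_iSup_of_nonneg])
    (fun f hf => by
      obtain ⟨b, hbs, hbA⟩ := hA f (fun z => by simpa using hf z)
      refine Summable.of_nonneg_of_le (fun n => Real.rpow_nonneg (h0 _) _) (fun n => ?_) hbs
      refine Real.rpow_le_rpow (h0 _) ?_ hp.le
      exact Real.iSup_le (fun a => (hbA a a.2 n).trans (le_abs_self _)) (abs_nonneg _))
  refine ⟨K, fun n f a W hW h => ?_⟩
  have := hK (Finset.range n) (fun k => if hk : k < n then f ⟨k, hk⟩ else 0) W hW fun z => by
    rw [Finset.sum_range]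
    simpa using h z
  rw [Finset.sum_range] at this
  refine le_trans (Finset.sum_le_sum fun k _ => ?_) this
  simp only [Fin.is_lt, dite_true, Fin.eta]
  exact Real.rpow_le_rpow (norm_nonneg _) (le_ciSup (hb (f k)) (a k)) hp.le

/-- The terms of a `p`-limited sequence contain no arbitrarily long tuples that are independent
across a fixed gap `r < s`: their Rademacher averages would violate `IsPLimited.exists_bound`. -/
theorem IsPLimited.exists_not_independent (hp : 1 ≤ p) {a : ℕ → Z}
    (ha : IsPLimited 𝕜 p (Set.range a)) {r s : ℝ} (hrs : r < s) :
    ∃ N : ℕ, ∀ n : Fin N → ℕ, ∃ σ : Fin N → Bool, ∀ f : StrongDual 𝕜 Z, ‖f‖ ≤ 1 →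
      ∃ k, ¬ if σ k then s < RCLike.re (f (a (n k))) else RCLike.re (f (a (n k))) < r := by
  have hp0 : 0 < p := by linarith
  obtain ⟨K, hK⟩ := ha.exists_bound hp0
  by_contra! hcon
  set δ := (s - r) / 2 with hδ
  have hδ0 : 0 < δ := by simp only [hδ]; linarith
  have key : ∀ N : ℕ, 0 < N → √N * δ ^ p ≤ K := by
    intro N hN
    obtain ⟨n, hn⟩ := hcon N
    choose f hf1 hf using hn
    let g : Fin N → StrongDual 𝕜 Z := fun k =>
      (2 ^ N : 𝕜)⁻¹ • ∑ σ : Fin N → Bool, boolSign 𝕜 (σ k) • f σ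
    have hg : ∀ k z, g k z = (2 ^ N : 𝕜)⁻¹ * ∑ σ : Fin N → Bool, boolSign 𝕜 (σ k) * f σ z := by
      intro k z
      simp [g]
    have hgz : ∀ z, ∑ k, ‖g k z‖ ≤ √N * ‖z‖ := fun z => by
      have := sum_norm_rademacher_average_le (fun σ => f σ z) (norm_nonneg z)
        fun σ => ((f σ).le_of_opNorm_le (hf1 σ) z).trans_eq (one_mul _)
      simpa only [hg, Fintype.card_fin] using this
    have hg1 : ∀ k, δ ≤ ‖g k (a (n k))‖ := fun k => by
      refine le_trans ?_ (RCLike.re_le_norm _)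
      -- Subtracting the midpoint is harmless since the signs sum to zero; it makes every term
      -- have real part at least `δ`.
      obtain ⟨m, hm⟩ : ∃ m, m = (r + s) / 2 := ⟨_, rfl⟩
      have e1 : g k (a (n k)) = (2 ^ N : 𝕜)⁻¹ *
          ∑ σ : Fin N → Bool, boolSign 𝕜 (σ k) * (f σ (a (n k)) - (m : 𝕜)) := by
        simp only [mul_sub, Finset.sum_sub_distrib, ← Finset.sum_mul, sum_boolSign, hg]
        simp
      have e2 : (2 ^ N : 𝕜)⁻¹ = (((2 ^ N : ℝ)⁻¹ : ℝ) : 𝕜) := by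
        simp only [RCLike.ofReal_inv, RCLike.ofReal_pow, RCLike.ofReal_ofNat]
      rw [e1, e2, RCLike.re_ofReal_mul, map_sum, le_inv_mul_iff₀ (by positivity)]
      have : (2 : ℝ) ^ N * δ = ∑ σ : Fin N → Bool, δ := by simp
      rw [this]
      refine Finset.sum_le_sum fun σ _ => ?_
      have h := hf σ k
      cases hσ : σ k <;> simp [hσ, boolSign] at h ⊢ <;> linarith
    have h1 := hK N g (fun k => ⟨a (n k), n k, rfl⟩) (√N) (by positivity) fun z => by
      have hle : ∀ k, ‖g k z‖ ≤ ‖z‖ := fun k => by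
        have h2 : ‖(2 ^ N : 𝕜)⁻¹‖ = (2 ^ N : ℝ)⁻¹ := by simp
        rw [hg, norm_mul, h2, inv_mul_le_iff₀ (by positivity)]
        refine (norm_sum_le _ _).trans ((Finset.sum_le_card_nsmul _ _ ‖z‖ fun σ _ => ?_).trans ?_)
        · rw [norm_mul, norm_boolSign, one_mul]
          exact ((f σ).le_of_opNorm_le (hf1 σ) z).trans_eq (one_mul _)
        · simp
      -- Since `1 ≤ p`, the bound on the sum of norms suffices, and no case distinction at `p = 2`
      -- is needed.
      calc ∑ k, ‖g k z‖ ^ p ≤ ∑ k, ‖g k z‖ * ‖z‖ ^ (p - 1) := by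
            refine Finset.sum_le_sum fun k _ => ?_
            have : ‖g k z‖ ^ p = ‖g k z‖ * ‖g k z‖ ^ (p - 1) := by
              conv_lhs => rw [show p = 1 + (p - 1) by ring,
                Real.rpow_add_of_nonneg (norm_nonneg _) zero_le_one (by linarith), Real.rpow_one]
            rw [this]
            gcongr
            exact hle k
        _ ≤ √N * ‖z‖ * ‖z‖ ^ (p - 1) := by
            rw [← Finset.sum_mul]
            gcongr
            exact hgz z
        _ = √N * ‖z‖ ^ p := by
            conv_rhs => rw [show p = 1 + (p - 1) by ring,
              Real.rpow_add_of_nonneg (norm_nonneg _) zero_le_one (by linarith), Real.rpow_one]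
            ring
    have h2 : N * δ ^ p ≤ ∑ k, ‖g k (a (n k))‖ ^ p := by
      have : (N : ℝ) * δ ^ p = ∑ _k : Fin N, δ ^ p := by simp
      rw [this]
      exact Finset.sum_le_sum fun k _ => Real.rpow_le_rpow hδ0.le (hg1 k) hp0.le
    have h3 : √N * (√N * δ ^ p) ≤ √N * K := by
      rw [← mul_assoc, Real.mul_self_sqrt (by positivity), mul_comm _ K]
      exact h2.trans h1
    exact le_of_mul_le_mul_left h3 (by positivity)
  have hδp : 0 < δ ^ p := by positivity
  obtain ⟨N, hN⟩ := exists_nat_gt ((K / δ ^ p) ^ 2)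
  have hN0 : 0 < N := by
    rw [← Nat.cast_pos (α := ℝ)]; exact (sq_nonneg _).trans_lt hN
  have h4 := key N hN0
  rw [← le_div_iff₀ hδp] at h4
  have h5 := Real.lt_sqrt_of_sq_lt hN
  linarith

/-- A `p`-limited sequence has a weakly Cauchy subsequence, expressed through real parts. -/
theorem IsPLimited.exists_strictMono_tendsto_re (hp : 1 ≤ p) {a : ℕ → Z}
    (ha : IsPLimited 𝕜 p (Set.range a)) :
    ∃ φ : ℕ → ℕ, StrictMono φ ∧
      ∀ f : StrongDual 𝕜 Z, ∃ c, Tendsto (fun n => RCLike.re (f (a (φ n)))) atTop (𝓝 c) := by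
  have hp0 : 0 < p := by linarith
  obtain ⟨φ, hφ, h⟩ := exists_strictMono_forall_not_frequently
    (α := {f : StrongDual 𝕜 Z // ‖f‖ ≤ 1}) (ι := {q : ℚ × ℚ // q.1 < q.2})
    (fun q b n => {f | if b then (q.1.2 : ℝ) < RCLike.re (f.1 (a n))
      else RCLike.re (f.1 (a n)) < (q.1.1 : ℝ)}) fun q => by
      obtain ⟨N, hN⟩ := ha.exists_not_independent hp (r := q.1.1) (s := q.1.2)
        (by exact_mod_cast q.2)
      refine ⟨N, fun n => ?_⟩
      obtain ⟨σ, hσ⟩ := hN n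
      exact ⟨σ, fun f => hσ f.1 f.2⟩
  refine ⟨φ, hφ, fun f => ?_⟩
  obtain ⟨R, hR⟩ := ha.exists_norm_le hp0
  -- Only functionals in the unit ball are controlled, so `f` is rescaled.
  have hpos : 0 < ‖f‖ + 1 := by positivity
  let g : StrongDual 𝕜 Z := (((‖f‖ + 1)⁻¹ : ℝ) : 𝕜) • f
  have hg : ‖g‖ ≤ 1 := by
    rw [norm_smul, RCLike.norm_ofReal, abs_of_nonneg (by positivity), inv_mul_le_iff₀ hpos]
    linarith
  have hga : ∀ n, |RCLike.re (g (a (φ n)))| ≤ R := fun n =>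
    (RCLike.abs_re_le_norm _).trans (((g.le_of_opNorm_le hg _).trans_eq (one_mul _)).trans
      (hR _ ⟨_, rfl⟩))
  obtain ⟨c, hc⟩ := tendsto_of_no_upcrossings (f := atTop)
    (u := fun n => RCLike.re (g (a (φ n)))) Rat.denseRange_cast (by
      rintro _ ⟨r, rfl⟩ _ ⟨s, rfl⟩ hrs ⟨h1, h2⟩
      obtain ⟨b, hb⟩ := h ⟨(r, s), by exact_mod_cast hrs⟩ ⟨g, hg⟩
      cases b
      · exact hb (by simpa using h1)
      · exact hb (by simpa using h2))
    (isBoundedUnder_of ⟨R, fun n => (abs_le.1 (hga n)).2⟩)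
    (isBoundedUnder_of ⟨-R, fun n => (abs_le.1 (hga n)).1⟩)
  refine ⟨(‖f‖ + 1) * c, (hc.const_mul _).congr fun n => ?_⟩
  simp only [g, _root_.smul_apply, smul_eq_mul, RCLike.re_ofReal_mul]
  field_simp

end PLimited

/-! ### Relative compactness in spaces of summing operators -/

section

variable {𝕜 : Type*} [RCLike 𝕜]

theorem IsPLimited.range_sub {Z : Type*} [NormedAddCommGroup Z] [NormedSpace 𝕜 Z] {p : ℝ}
    {A : Set Z} (hA : IsPLimited 𝕜 p A) {b c : ℕ → Z} (hb : ∀ n, b n ∈ A) (hc : ∀ n, c n ∈ A) :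
    IsPLimited 𝕜 p (Set.range fun n => b n - c n) := by
  intro f hf
  obtain ⟨a, ha, haA⟩ := hA f hf
  refine ⟨fun n => 2 * a n, ?_, ?_⟩
  · simp only [abs_mul, Real.mul_rpow (abs_nonneg _) (abs_nonneg _)]
    exact ha.mul_left _
  · rintro _ ⟨k, rfl⟩ n
    simp only [map_sub, two_mul]
    exact (norm_sub_le _ _).trans (add_le_add (haA _ (hb k) n) (haA _ (hc k) n))

variable {X : Type*} [NormedAddCommGroup X] [NormedSpace 𝕜 X]
  {Y : Type*} [NormedAddCommGroup Y] [NormedSpace 𝕜 Y]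

theorem ContinuousLinearMap.exists_norm_le_two_mul_norm_comp (T : X →L[𝕜] Y) :
    ∃ y : StrongDual 𝕜 Y, ‖y‖ ≤ 1 ∧ ‖T‖ ≤ 2 * ‖y.comp T‖ := by
  by_cases hT : T = 0
  · exact ⟨0, by simp, by simp [hT]⟩
  have hpos : 0 < ‖T‖ := norm_pos_iff.2 hT
  obtain ⟨x, hx, hTx⟩ := T.exists_lt_apply_of_lt_opNorm (r := ‖T‖ / 2) (by linarith)
  obtain ⟨y, hy, hyx⟩ := exists_dual_vector'' 𝕜 (T x)
  refine ⟨y, hy, ?_⟩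
  have h1 : ‖T x‖ ≤ ‖y.comp T‖ := by
    calc ‖T x‖ = ‖y.comp T x‖ := by simp [hyx]
      _ ≤ ‖y.comp T‖ * ‖x‖ := le_opNorm _ _
      _ ≤ _ := mul_le_of_le_one_right (norm_nonneg _) hx.le
  linarith

/-- For a `p`-limited sequence `S` in a space of `p`-summing operators, and `y` in the unit ball of
`Y*`, the functionals `y n ∘ S n` form a `p`-limited subset of `X*`. -/
theorem IsPLimited.range_comp {p : ℝ} (hp : 1 ≤ p) {M : Submodule 𝕜 (X →L[𝕜] Y)}
    (hM : ∀ T ∈ M, IsPSumming p T) {S : ℕ → M} (hS : IsPLimited 𝕜 p (Set.range S))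
    {y : ℕ → StrongDual 𝕜 Y} (hy : ∀ n, ‖y n‖ ≤ 1) :
    IsPLimited 𝕜 p (Set.range fun n => (y n).comp (S n : X →L[𝕜] Y)) := by
  intro ξ hξ
  have hp0 : 0 < p := by linarith
  obtain ⟨R, hR⟩ := hS.exists_norm_le hp0
  let u : ℕ → StrongDual 𝕜 X := fun n => (y n).comp (S n : X →L[𝕜] Y)
  have hu : ∀ n, ‖u n‖ ≤ R := fun n =>
    ((y n).opNorm_comp_le _).trans ((mul_le_of_le_one_left (norm_nonneg _) (hy n)).trans
      (hR _ ⟨n, rfl⟩))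
  have hbdd : ∀ k, BddAbove (Set.range fun n => ‖ξ k (u n)‖) := fun k => by
    refine ⟨‖ξ k‖ * R, ?_⟩
    rintro _ ⟨n, rfl⟩
    exact ((ξ k).le_opNorm _).trans (mul_le_mul_of_nonneg_left (hu n) (norm_nonneg _))
  have hex : ∀ k, ∃ m, ∀ n, ‖ξ k (u n)‖ ≤ 2 * ‖ξ k (u m)‖ := by
    intro k
    rcases (Real.iSup_nonneg fun n => norm_nonneg (ξ k (u n))).eq_or_lt with h0 | h0
    · exact ⟨0, fun n => ((le_ciSup (hbdd k) n).trans h0.symm.le).trans (by positivity)⟩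
    · obtain ⟨m, hm⟩ := exists_lt_of_lt_ciSup (half_lt_self h0)
      exact ⟨m, fun n => (le_ciSup (hbdd k) n).trans (by linarith)⟩
  -- `m k` almost maximizes `‖ξ k (u n)‖` over `n`, so a bound for `F k` at the point `S (m k)` bounds
  -- `ξ k` on the whole range of `u`.
  choose m hm using hex
  let F : ℕ → StrongDual 𝕜 M := fun k =>
    ((ξ k).comp (ContinuousLinearMap.compL 𝕜 X Y 𝕜 (y (m k)))).comp M.subtypeL
  obtain ⟨a, ha, haS⟩ := hS F fun T => (hM T T.2).summable_bidual hp hξ _ fun k => hy (m k)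
  refine ⟨fun k => 2 * a k, ?_, ?_⟩
  · simp only [abs_mul, Real.mul_rpow (abs_nonneg _) (abs_nonneg _)]
    exact ha.mul_left _
  · rintro _ ⟨n, rfl⟩ k
    exact (hm k n).trans (mul_le_mul_of_nonneg_left (haS _ ⟨m k, rfl⟩ k) zero_le_two)

theorem tendsto_zero_of_isCompact_closure_range {u : ℕ → StrongDual 𝕜 X}
    (hu : IsCompact (closure (Set.range u))) (h0 : ∀ x, Tendsto (fun n => u n x) atTop (𝓝 0)) :
    Tendsto u atTop (𝓝 0) := by
  refine tendsto_of_subseq_tendsto fun ns hns => ?_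
  obtain ⟨v, -, φ, hφm, hφ⟩ := hu.tendsto_subseq fun n => subset_closure ⟨ns n, rfl⟩
  refine ⟨φ, ?_⟩
  have : v = 0 := by
    ext x
    refine tendsto_nhds_unique (((ContinuousLinearMap.apply 𝕜 𝕜 x).continuous.tendsto v).comp hφ) ?_
    exact ((h0 x).comp hns).comp hφm.tendsto_atTop
  rwa [this] at hφ

theorem tendsto_norm_zero_of_weaklyNull {p : ℝ} (hp : 1 ≤ p)
    (hX : HasWeakPGP 𝕜 (StrongDual 𝕜 X) p) {M : Submodule 𝕜 (X →L[𝕜] Y)}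
    (hsum : ∀ T ∈ M, IsPSumming p T) (hlcc : ∀ x : X, IsPLcc p (evalOn M x)) {S : ℕ → M}
    (hS : IsPLimited 𝕜 p (Set.range S)) (hS0 : WeaklyNull 𝕜 S) :
    Tendsto (fun n => ‖S n‖) atTop (𝓝 0) := by
  choose y hy1 hy2 using fun n => (S n : X →L[𝕜] Y).exists_norm_le_two_mul_norm_comp
  have h1 := tendsto_zero_of_isCompact_closure_range (hX _ (hS.range_comp hp hsum hy1)) fun x =>
    squeeze_zero_norm (fun n => ((y n).le_of_opNorm_le (hy1 n) _).trans_eq (one_mul _))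
      (hlcc x S hS hS0)
  have h2 := h1.norm.const_mul 2
  rw [norm_zero, mul_zero] at h2
  exact squeeze_zero (fun n => norm_nonneg _) hy2 h2

/-- If `p`-limited weakly null sequences are norm null, every sequence in a `p`-limited set has a
norm Cauchy subsequence: a weakly Cauchy subsequence is one, since otherwise differences of its
terms form a weakly null sequence bounded away from zero. -/
theorem IsPLimited.exists_strictMono_cauchySeq {Z : Type*} [NormedAddCommGroup Z]
    [NormedSpace 𝕜 Z] {p : ℝ} (hp : 1 ≤ p)
    (hnull : ∀ S : ℕ → Z, IsPLimited 𝕜 p (Set.range S) → WeaklyNull 𝕜 S →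
      Tendsto (fun n => ‖S n‖) atTop (𝓝 0))
    {A : Set Z} (hA : IsPLimited 𝕜 p A) {b : ℕ → Z} (hb : ∀ n, b n ∈ A) :
    ∃ φ : ℕ → ℕ, StrictMono φ ∧ CauchySeq (b ∘ φ) := by
  obtain ⟨φ, hφ, hre⟩ := (hA.mono (Set.range_subset_iff.2 hb)).exists_strictMono_tendsto_re hp
  refine ⟨φ, hφ, ?_⟩
  by_contra hcon
  rw [Metric.cauchySeq_iff] at hcon
  push Not at hcon
  obtain ⟨ε, hε, hcon⟩ := hcon
  choose m hm l hl hml using hcon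
  have hm' : Tendsto m atTop atTop := tendsto_atTop_mono hm tendsto_id
  have hl' : Tendsto l atTop atTop := tendsto_atTop_mono hl tendsto_id
  have hRe : ∀ f : StrongDual 𝕜 Z,
      Tendsto (fun n => RCLike.re (f (b (φ (m n)) - b (φ (l n))))) atTop (𝓝 0) := fun f => by
    obtain ⟨c, hc⟩ := hre f
    simpa using (hc.comp hm').sub (hc.comp hl')
  have h := hnull (fun n => b (φ (m n)) - b (φ (l n)))
    (hA.range_sub (fun n => hb _) fun n => hb _) fun f => by
      -- A scalar `z` is recovered from the real parts of `z` and of `-I * z`, also when `I = 0`.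
      have h1 := (RCLike.continuous_ofReal (K := 𝕜)).continuousAt.tendsto.comp (hRe f)
      have h2 := (RCLike.continuous_ofReal (K := 𝕜)).continuousAt.tendsto.comp
        (hRe ((-RCLike.I : 𝕜) • f))
      have h3 := h1.add (h2.mul_const (RCLike.I : 𝕜))
      simp only [RCLike.ofReal_zero, zero_mul, add_zero] at h3
      refine h3.congr fun n => ?_
      have e : ∀ z : 𝕜, RCLike.re (-RCLike.I * z) = RCLike.im z := fun z => by
        simp [RCLike.mul_re]
      simp only [Function.comp_apply, _root_.smul_apply, smul_eq_mul, e, RCLike.re_add_im]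
  refine absurd (ge_of_tendsto' h fun n => ?_) (not_le.2 hε)
  simpa [dist_eq_norm] using hml n

theorem isCompact_closure_of_forall_exists_cauchySeq {Z : Type*} [PseudoMetricSpace Z]
    [CompleteSpace Z] {A : Set Z}
    (hA : ∀ b : ℕ → Z, (∀ n, b n ∈ A) → ∃ φ : ℕ → ℕ, StrictMono φ ∧ CauchySeq (b ∘ φ)) :
    IsCompact (closure A) := by
  refine IsSeqCompact.isCompact fun z hz => ?_
  have hb : ∀ n : ℕ, ∃ b ∈ A, dist (z n) b < 1 / ((n : ℝ) + 1) := fun n =>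
    Metric.mem_closure_iff.1 (hz n) _ Nat.one_div_pos_of_nat
  choose b hbA hzb using hb
  obtain ⟨φ, hφ, hc⟩ := hA b hbA
  obtain ⟨c, hbc⟩ := cauchySeq_tendsto_of_complete hc
  refine ⟨c, mem_closure_of_tendsto hbc (Eventually.of_forall fun n => hbA _), φ, hφ, ?_⟩
  refine (tendsto_iff_of_dist ?_).2 hbc
  exact squeeze_zero (fun _ => dist_nonneg) (fun n => (hzb (φ n)).le)
    (tendsto_one_div_add_atTop_nhds_zero_nat.comp hφ.tendsto_atTop)

end

theorem theorem2p3 {𝕜 : Type*} [RCLike 𝕜]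
    {X : Type*} [NormedAddCommGroup X] [NormedSpace 𝕜 X] [CompleteSpace X]
    {Y : Type*} [NormedAddCommGroup Y] [NormedSpace 𝕜 Y] [CompleteSpace Y]
    (p : ℝ) (hp : 1 ≤ p)
    (hX : HasWeakPGP 𝕜 (StrongDual 𝕜 X) p)
    (M : Submodule 𝕜 (X →L[𝕜] Y)) (hM : IsClosed (M : Set (X →L[𝕜] Y)))
    (hsum : ∀ T ∈ M, IsPSumming p T)
    (hlcc : ∀ x : X, IsPLcc p (evalOn M x)) :
    HasWeakPGP 𝕜 M p := by
  have : CompleteSpace M := hM.completeSpace_coe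
  exact fun A hA => isCompact_closure_of_forall_exists_cauchySeq fun b hb =>
    hA.exists_strictMono_cauchySeq hp
      (fun S hS hS0 => tendsto_norm_zero_of_weaklyNull hp hX hsum hlcc hS hS0) hb
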